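/- A bandit range searching instance consists of $n$ arms, a point $p_a\in\mathbb R$ for each arm $a\in[n]$, and a finite collection $\mathcal I=\{[\ell_i,r_i]\}_{i=1}^q$ of real intervals with $\ell_i<r_i$, each containing at least one of the points $p_a$. Arm $a$ has an unknown distribution $\nu_a$ supported on $[0,1]$, whose mean $\mu_a$ is the weight of the arm; an algorithm (adaptive, possibly randomized) knows the instance, draws independent samples from arms of its choice, and at some time stops and reports one arm for each interval. An arm $a$ with $p_a\in[\ell_i,r_i]$ is $\varepsilon$-optimal for $[\ell_i,r_i]$ if $\mu_a\ge\mu_b-\varepsilon$ for all arms $b$ with $p_b\in[\ell_i,r_i]$. The algorithm has the $(\varepsilon,\delta)$-PAC guarantee for the instance if, for all distributions $\nu_1,\dots,\nu_n$ on $[0,1]$, with probability at least $1-\delta$ it stops and reports an $\varepsilon$-optimal arm for every interval. A hitting set of $\mathcal I$ is a finite set of reals that contains a point of the interior of every interval of $\mathcal I$. **Theorem.** There is a universal constant $c>0$ such that for every integer $\tau\ge 1$, every $\varepsilon\in(0,1/8]$ and every integer $n\ge \frac{\tau}{4\varepsilon}$ there is a bandit range searching instance with $n$ arms and interval collection $\mathcal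 I$ such that the minimum cardinality of a hitting set of $\mathcal I$ is $\tau$, and such that the following holds for every $\delta\in(0,1/4]$: for any algorithm that has the $(\varepsilon,\delta)$-PAC guarantee for this instance there are distributions of the arms on $[0,1]$ under which its expected number of samples is at least $$c\cdot\frac{n}{\varepsilon^2}\,\log\!\Big(\frac{\tau}{\varepsilon\delta}\Big).$$ -/

import Mathlib

open MeasureTheory
open scoped ENNReal

universe u

noncomputable section

/-- A bandit range searching instance with `n` arms and `q` intervals: arm `a` sits at the real
point `point a`, and the `i`-th interval is `[left i, right i]`. Each interval has non-empty
interior, and contains at least one arm (so that an arm can be reported for it). -/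
structure RangeInstance (n q : ℕ) where
  point : Fin n → ℝ
  left : Fin q → ℝ
  right : Fin q → ℝ
  left_lt_right : ∀ i, left i < right i
  exists_arm : ∀ i, ∃ a, left i ≤ point a ∧ point a ≤ right i

namespace RangeInstance

variable {n q : ℕ}

/-- The set of arms whose points lie in the `i`-th interval. -/
def armsIn (R : RangeInstance n q) (i : Fin q) : Set (Fin n) :=
  {a | R.left i ≤ R.point a ∧ R.point a ≤ R.right i}

/-- `H` contains a point of the interior of every interval. -/
def IsHittingSet (R : RangeInstance n q) (H : Finset ℝ) : Prop :=
  ∀ i, ∃ e ∈ H, R.left i < e ∧ e < R.right i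

/-- The minimum cardinality of a hitting set for the intervals is `τ`. -/
def OptimalHittingSetSize (R : RangeInstance n q) (τ : ℕ) : Prop :=
  IsLeast {k : ℕ | ∃ H : Finset ℝ, R.IsHittingSet H ∧ H.card = k} τ

/-- Arm `a` is `ε`-optimal for the `i`-th interval, when the weights of the arms are `w`. -/
def IsEpsOptimal (R : RangeInstance n q) (w : Fin n → ℝ) (ε : ℝ) (i : Fin q) (a : Fin n) : Prop :=
  a ∈ R.armsIn i ∧ ∀ b ∈ R.armsIn i, w b - ε ≤ w a

end RangeInstance

/-- Every arm has its distribution supported on `[0,1]`. -/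
def SupportedOnUnit {n : ℕ} (ν : Fin n → ProbabilityMeasure ℝ) : Prop :=
  ∀ a, (ν a : Measure ℝ) (Set.Icc 0 1) = 1

/-- The weight of an arm: the mean of its distribution. -/
def weight {n : ℕ} (ν : Fin n → ProbabilityMeasure ℝ) (a : Fin n) : ℝ :=
  ∫ x, x ∂(ν a : Measure ℝ)

/-- What an algorithm may do next: draw a sample from an arm, or stop and report one arm for
every interval. -/
inductive Decision (n q : ℕ) : Type where
  | pull (a : Fin n) : Decision n q
  | halt (answer : Fin q → Fin n) : Decision n q

/-- A (randomized, adaptive) sampling algorithm for `n` arms and `q` intervals. Its internal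
randomness is a random seed; given the seed, the next decision is a (measurable) function of the
finite list of all (arm, observed sample) pairs so far, in chronological order. -/
structure SamplingAlgorithm (n q : ℕ) : Type (u + 1) where
  Seed : Type u
  [seedSpace : MeasurableSpace Seed]
  seedLaw : ProbabilityMeasure Seed
  next : Seed → List (Fin n × ℝ) → Decision n q
  measurable_next : ∀ (t : ℕ) (arms : Fin t → Fin n) (d : Decision n q),
    MeasurableSet {p : Seed × (Fin t → ℝ) |
      next p.1 (List.ofFn fun s => (arms s, p.2 s)) = d}

namespace SamplingAlgorithm

variable {n q : ℕ}

instance (A : SamplingAlgorithm n q) : MeasurableSpace A.Seed := A.seedSpace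

/-- The outcomes of a run: the seed, and for every arm `a` and `j : ℕ` the value `x (a, j)` that
is observed at the `j`-th draw from arm `a` (counting from zero). -/
abbrev Outcome (A : SamplingAlgorithm n q) : Type _ := A.Seed × (Fin n × ℕ → ℝ)

/-- The law of the outcomes when arm `a` has distribution `ν a`: all draws are independent, the
draws from arm `a` are distributed as `ν a`, and the seed is independent of all the draws. -/
def law (A : SamplingAlgorithm n q) (ν : Fin n → ProbabilityMeasure ℝ) : Measure A.Outcome :=
  (A.seedLaw : Measure A.Seed).prod
    (Measure.infinitePi fun p : Fin n × ℕ => (ν p.1 : Measure ℝ))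

/-- The list of (arm, observed sample) pairs after `t` steps; it stays constant once the
algorithm has stopped. -/
def history (A : SamplingAlgorithm n q) (ω : A.Outcome) : ℕ → List (Fin n × ℝ)
  | 0 => []
  | t + 1 =>
    match A.next ω.1 (A.history ω t) with
    | .pull a =>
        A.history ω t ++ [(a, ω.2 (a, ((A.history ω t).map Prod.fst).count a))]
    | .halt _ => A.history ω t

/-- The algorithm stops at some time and then reports `answer`. -/
def Reports (A : SamplingAlgorithm n q) (ω : A.Outcome) (answer : Fin q → Fin n) : Prop :=
  ∃ t, A.next ω.1 (A.history ω t) = .halt answer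

/-- The total number of samples drawn (infinite if the algorithm never stops). -/
def numSamples (A : SamplingAlgorithm n q) (ω : A.Outcome) : ℝ≥0∞ :=
  ⨆ t, ((A.history ω t).length : ℝ≥0∞)

/-- The expected number of samples drawn when arm `a` has distribution `ν a`. -/
def expectedSamples (A : SamplingAlgorithm n q) (ν : Fin n → ProbabilityMeasure ℝ) : ℝ≥0∞ :=
  ∫⁻ ω, A.numSamples ω ∂(A.law ν)

/-- The `(ε, δ)`-PAC guarantee on the instance `R`: whatever the unknown distributions of the arms
on `[0,1]`, with probability at least `1 - δ` the algorithm stops and reports an `ε`-optimal arm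
for every interval. -/
def IsPAC (A : SamplingAlgorithm n q) (R : RangeInstance n q) (ε δ : ℝ) : Prop :=
  ∀ ν : Fin n → ProbabilityMeasure ℝ, SupportedOnUnit ν →
    ENNReal.ofReal (1 - δ) ≤
      A.law ν {ω | ∃ answer, A.Reports ω answer ∧
        ∀ i, R.IsEpsOptimal (weight ν) ε i (answer i)}

end SamplingAlgorithm

end

/-! The hard instance consists of `τ` blocks of `m ≈ 1/(8ε)` groups, `K = τ * m` groups in all. The
`g`-th interval contains the groups of its block up to `g`, and base weights climb by `4ε` from
group to group. The last group therefore outweighs the earlier ones, and the interval asks for the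
best arm of group `g`. Each group has a reference arm, `2ε` above the base, and `M ≈ n/K` candidates
at the base, one of which may be raised by `4ε`. For every choice of raised groups `S` and raised
candidates `c`, each interval has a unique `ε`-optimal arm (`eq_bestArm_of_isEpsOptimal`). The
algorithm thus solves `K` best-arm problems at once.

Lowering the raised candidate of one group changes a single arm. An answer likely in the lowered
world keeps, in the raised world, probability at least `1/3 * exp(-C * t)`, where `C` is of order
`ε²` and `t` is the expected number of samples of that candidate in the lowered world
(`exp_le_law_reports`, by Cauchy–Schwarz on the likelihood ratio).

The factor `log K` comes from disjointness: in the world `(S, c)`, the wrong answers obtained by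
resetting one group of `S` to its reference are pairwise distinct, so their probabilities add up to
at most `δ` (`sum_law_real_reports_le`). Averaging over `S`, `c`, the group and the candidate, with
convexity of `exp`, gives `exp(-C * y) ≲ δ/K`, where `y = 2V/(K * M)` and `V` bounds the expected
total number of samples (`exp_le_of_sum_le`). Hence `V ≳ (n/ε²) * log(K/δ)`, and `K` is of order
`τ/ε`. -/

namespace MeasureTheory

/-! ### Densities of product measures and Cauchy–Schwarz. -/

/-- Changing finitely many factors of a product measure by densities changes the product measure
by the product of these densities. -/
theorem Measure.infinitePi_eq_withDensity {ι X : Type*} [MeasurableSpace X]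
    (μ ν : ι → Measure X) [∀ i, IsProbabilityMeasure (μ i)] [∀ i, IsProbabilityMeasure (ν i)]
    (f : ι → X → ℝ≥0∞) (hf : ∀ i, Measurable (f i)) (s : Finset ι)
    (hs : ∀ i ∈ s, ν i = (μ i).withDensity (f i)) (hsc : ∀ i ∉ s, ν i = μ i) :
    Measure.infinitePi ν =
      (Measure.infinitePi μ).withDensity (fun x => ∏ i ∈ s, f i (x i)) := by
  classical
  symm
  refine Measure.eq_infinitePi _ fun t B hB => ?_
  -- On a box, indicator times density is a product of functions of single coordinates, so
  -- independence factorizes its integral.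
  let g : ι → X → ℝ≥0∞ := fun i x =>
    (if i ∈ t then (B i).indicator 1 x else 1) * (if i ∈ s then f i x else 1)
  have hg : ∀ i, Measurable (g i) := by
    intro i
    refine Measurable.mul ?_ ?_
    · split_ifs
      · exact measurable_one.indicator (hB i)
      · exact measurable_const
    · split_ifs
      · exact hf i
      · exact measurable_const
  have hBm : MeasurableSet (Set.pi (t : Set ι) B) :=
    .pi t.countable_toSet fun _ _ => hB _
  rw [withDensity_apply _ hBm, ← lintegral_indicator hBm]
  have key : ∀ x : ι → X, (Set.pi (t : Set ι) B).indicator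
      (fun x => ∏ i ∈ s, f i (x i)) x = ∏ i ∈ t ∪ s, g i (x i) := by
    intro x
    simp only [g, Finset.prod_mul_distrib]
    rw [Finset.prod_ite_mem, Finset.prod_ite_mem, Finset.inter_eq_right.2 Finset.subset_union_left,
      Finset.inter_eq_right.2 Finset.subset_union_right]
    by_cases hx : x ∈ Set.pi (t : Set ι) B
    · have h1 : ∏ i ∈ t, (B i).indicator (1 : X → ℝ≥0∞) (x i) = 1 :=
        Finset.prod_eq_one fun i hi => by rw [Set.indicator_of_mem (hx i hi)]; rfl
      rw [Set.indicator_of_mem hx, h1, one_mul]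
    · rw [Set.indicator_of_notMem hx]
      simp only [Set.mem_pi, not_forall] at hx
      obtain ⟨i, hi, hxi⟩ := hx
      rw [Finset.prod_eq_zero (i := i) hi (by rw [Set.indicator_of_notMem hxi]), zero_mul]
  rw [lintegral_congr key]
  have hind := ProbabilityTheory.iIndepFun_infinitePi (P := μ) (X := g) hg
  rw [ProbabilityTheory.lintegral_prod_eq_prod_lintegral_of_indepFun _ _ hind
    (fun i => (hg i).comp (measurable_pi_apply i))]
  have heval : ∀ i, ∫⁻ x : ι → X, g i (x i) ∂(Measure.infinitePi μ) = ∫⁻ y, g i y ∂(μ i) := by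
    intro i
    rw [← (measurePreserving_eval_infinitePi μ i).lintegral_comp (hg i)]
  have hval : ∀ i, ∫⁻ y, g i y ∂(μ i) = if i ∈ t then ν i (B i) else 1 := by
    intro i
    have h1 : ∀ h : X → ℝ≥0∞, ∫⁻ y, (B i).indicator 1 y * h y ∂(μ i) = ∫⁻ y in B i, h y ∂(μ i) := by
      intro h
      rw [← lintegral_indicator (hB i)]
      refine lintegral_congr fun y => ?_
      by_cases hy : y ∈ B i <;> simp [hy]
    by_cases his : i ∈ s
    · by_cases hit : i ∈ t
      · simp only [g, his, hit, if_true]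
        rw [h1, hs i his, withDensity_apply _ (hB i)]
      · simp only [g, his, hit, if_true, if_false, one_mul]
        have := measure_univ (μ := ν i)
        rwa [hs i his, withDensity_apply _ .univ, setLIntegral_univ] at this
    · by_cases hit : i ∈ t
      · simp only [g, his, hit, if_true, if_false]
        rw [h1, hsc i his]
        simp
      · simp [g, his, hit]
  simp only [heval, hval]
  rw [Finset.prod_ite_mem, Finset.inter_eq_right.2 Finset.subset_union_left]

/-- The Cauchy–Schwarz inequality for the measure of a set, in terms of the second moment of a
density. -/
theorem withDensity_sq_le {Ω : Type*} [MeasurableSpace Ω] (P : Measure Ω)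
    (f : Ω → ℝ≥0∞) (hf : Measurable f) {E : Set Ω} (hE : MeasurableSet E) :
    (P.withDensity f E) ^ 2 ≤ P E * ∫⁻ x, f x ^ 2 ∂P := by
  have h := ENNReal.lintegral_mul_le_Lp_mul_Lq P Real.HolderConjugate.two_two
    (f := E.indicator 1) (g := f) (measurable_one.indicator hE).aemeasurable hf.aemeasurable
  have h1 : ∫⁻ a, (E.indicator (1 : Ω → ℝ≥0∞) * f) a ∂P = P.withDensity f E := by
    rw [withDensity_apply _ hE, ← lintegral_indicator hE]
    refine lintegral_congr fun y => ?_
    by_cases hy : y ∈ E <;> simp [hy]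
  have h2 : ∫⁻ a, (E.indicator (1 : Ω → ℝ≥0∞) a) ^ (2 : ℝ) ∂P = P E := by
    rw [← lintegral_indicator_one hE]
    refine lintegral_congr fun y => ?_
    by_cases hy : y ∈ E <;> simp [hy]
  rw [h1, h2] at h
  have h3 := pow_le_pow_left₀ (by simp) h 2
  refine h3.trans (le_of_eq ?_)
  rw [mul_pow, ← ENNReal.rpow_natCast, ← ENNReal.rpow_natCast, ← ENNReal.rpow_mul,
    ← ENNReal.rpow_mul]
  norm_num

end MeasureTheory

/-! ### Bernoulli arms and their likelihood ratios. -/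

/-- The Bernoulli distribution on the real line with success probability `p`. -/
noncomputable def bernoulliReal (p : unitInterval) : ProbabilityMeasure ℝ :=
  ⟨ENNReal.ofReal p • Measure.dirac 1 + ENNReal.ofReal (1 - p) • Measure.dirac 0, ⟨by
    simp only [Measure.coe_add, Measure.coe_smul, Pi.add_apply, Pi.smul_apply, measure_univ,
      smul_eq_mul, mul_one]
    rw [← ENNReal.ofReal_add p.2.1 (by linarith [p.2.2])]
    simp⟩⟩

theorem bernoulliReal_toMeasure (p : unitInterval) : (bernoulliReal p : Measure ℝ) =
    ENNReal.ofReal p • Measure.dirac 1 + ENNReal.ofReal (1 - p) • Measure.dirac 0 := rfl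

theorem bernoulliReal_Icc (p : unitInterval) :
    (bernoulliReal p : Measure ℝ) (Set.Icc 0 1) = 1 := by
  rw [bernoulliReal_toMeasure]
  simp only [Measure.coe_add, Measure.coe_smul, Pi.add_apply, Pi.smul_apply, smul_eq_mul]
  rw [Measure.dirac_apply_of_mem (by simp), Measure.dirac_apply_of_mem (by simp), mul_one, mul_one,
    ← ENNReal.ofReal_add p.2.1 (by linarith [p.2.2])]
  simp

theorem integral_bernoulliReal (p : unitInterval) :
    ∫ x, x ∂(bernoulliReal p : Measure ℝ) = p := by
  rw [bernoulliReal_toMeasure, integral_add_measure, integral_smul_measure, integral_smul_measure]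
  · simp [ENNReal.toReal_ofReal p.2.1]
  · exact (integrable_dirac (by simp)).smul_measure ENNReal.ofReal_ne_top
  · exact (integrable_dirac (by simp)).smul_measure ENNReal.ofReal_ne_top

/-- The density of a Bernoulli distribution with respect to another one. -/
noncomputable def bernoulliDensity (p r : unitInterval) (x : ℝ) : ℝ≥0∞ :=
  Set.indicator {1} (fun _ => ENNReal.ofReal (p / r)) x +
    Set.indicator {1}ᶜ (fun _ => ENNReal.ofReal ((1 - p) / (1 - r))) x

theorem measurable_bernoulliDensity (p r : unitInterval) : Measurable (bernoulliDensity p r) :=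
  (measurable_const.indicator (measurableSet_singleton _)).add
    (measurable_const.indicator (measurableSet_singleton _).compl)

theorem bernoulliReal_eq_withDensity (p r : unitInterval) (h0 : 0 < (r : ℝ)) (h1 : (r : ℝ) < 1) :
    (bernoulliReal p : Measure ℝ) =
      (bernoulliReal r : Measure ℝ).withDensity (bernoulliDensity p r) := by
  classical
  have h1' : 0 < 1 - (r : ℝ) := by linarith
  have hd : ∀ a : ℝ, (Measure.dirac a).withDensity (bernoulliDensity p r) =
      bernoulliDensity p r a • Measure.dirac a := by
    intro a
    ext s hs
    rw [withDensity_apply _ hs, Measure.smul_apply, restrict_dirac' hs]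
    split_ifs with h <;> simp [h]
  rw [bernoulliReal_toMeasure, bernoulliReal_toMeasure, withDensity_add_measure,
    withDensity_smul_measure, withDensity_smul_measure, hd, hd, smul_smul, smul_smul]
  have e1 : ENNReal.ofReal r * bernoulliDensity p r 1 = ENNReal.ofReal p := by
    simp only [bernoulliDensity, Set.mem_singleton_iff, Set.indicator_of_mem, Set.mem_compl_iff,
      not_true_eq_false, not_false_eq_true, Set.indicator_of_notMem, add_zero]
    rw [← ENNReal.ofReal_mul h0.le, mul_div_cancel₀ _ h0.ne']
  have e0 : ENNReal.ofReal (1 - r) * bernoulliDensity p r 0 = ENNReal.ofReal (1 - p) := by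
    have : (0 : ℝ) ∉ ({1} : Set ℝ) := by simp
    simp only [bernoulliDensity, Set.indicator_of_notMem this, Set.indicator_of_mem
      (Set.mem_compl this), zero_add]
    rw [← ENNReal.ofReal_mul h1'.le, mul_div_cancel₀ _ h1'.ne']
  rw [e1, e0]

/-- One plus the chi-square divergence: the price of one sample in the change of measure. -/
theorem lintegral_bernoulliDensity_sq (p r : unitInterval) (h0 : 0 < (r : ℝ)) (h1 : (r : ℝ) < 1) :
    ∫⁻ x, bernoulliDensity p r x ^ 2 ∂(bernoulliReal r : Measure ℝ) =
      ENNReal.ofReal (1 + ((p : ℝ) - r) ^ 2 / (r * (1 - r))) := by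
  have h1' : 0 < 1 - (r : ℝ) := by linarith
  have hp := p.2.1
  have hp1 : 0 ≤ 1 - (p : ℝ) := by linarith [p.2.2]
  have h : (0 : ℝ) ∉ ({1} : Set ℝ) := by simp
  rw [bernoulliReal_toMeasure, lintegral_add_measure, lintegral_smul_measure,
    lintegral_smul_measure, lintegral_dirac, lintegral_dirac]
  simp only [bernoulliDensity, Set.mem_singleton_iff, Set.indicator_of_mem, Set.mem_compl_iff,
      not_true_eq_false, not_false_eq_true, Set.indicator_of_notMem, add_zero,
      Set.indicator_of_notMem h, Set.indicator_of_mem (Set.mem_compl h), zero_add, smul_eq_mul]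
  rw [← ENNReal.ofReal_pow (by positivity), ← ENNReal.ofReal_pow (by positivity),
    ← ENNReal.ofReal_mul h0.le, ← ENNReal.ofReal_mul h1'.le,
    ← ENNReal.ofReal_add (by positivity) (by positivity)]
  congr 1
  field_simp
  ring

/-! ### Runs of an algorithm: measurability and sample counts. -/

instance Decision.instCountable (n q : ℕ) : Countable (Decision n q) := by
  let f : Decision n q → Fin n ⊕ (Fin q → Fin n) := fun d =>
    match d with
    | .pull a => .inl a
    | .halt ans => .inr ans
  refine Function.Injective.countable (f := f) ?_
  rintro (a | a) (b | b) h <;> simp_all [f]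

namespace SamplingAlgorithm

variable {n q : ℕ}

/-- The list of (arm, observed sample) pairs when the arms in `l` are sampled in this order. -/
def samplesOf (x : Fin n × ℕ → ℝ) (l : List (Fin n)) : List (Fin n × ℝ) :=
  List.ofFn fun s : Fin l.length => (l.get s, x (l.get s, (l.take s).count (l.get s)))

theorem samplesOf_append (x : Fin n × ℕ → ℝ) (l : List (Fin n)) (a : Fin n) :
    samplesOf x (l ++ [a]) = samplesOf x l ++ [(a, x (a, l.count a))] := by
  refine List.ext_getElem (by simp [samplesOf]) fun i h1 h2 => ?_
  simp only [samplesOf, List.length_ofFn, List.length_append, List.length_singleton] at h1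
  simp only [samplesOf, List.getElem_ofFn, List.get_eq_getElem]
  by_cases hi : i < l.length
  · simp only [List.getElem_append, List.length_ofFn, hi, dif_pos, List.getElem_ofFn,
      List.take_append_of_le_length hi.le]
  · obtain rfl : i = l.length := by omega
    rw [List.getElem_append_right (by simp)]
    simp

/-- Once the sequence of arms is fixed, the observations are fixed coordinates of the outcome.
Events about runs thus become countable unions over arm sequences, which yields their measurability.
-/
theorem history_eq_samplesOf (A : SamplingAlgorithm.{u} n q) (ω : A.Outcome) (t : ℕ) :
    A.history ω t = samplesOf ω.2 ((A.history ω t).map Prod.fst) := by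
  induction t with
  | zero => simp [history, samplesOf]
  | succ t ih =>
    rw [history]
    split
    · rw [List.map_append, List.map_singleton, samplesOf_append, ← ih]
    · exact ih

theorem measurableSet_next_samplesOf (A : SamplingAlgorithm.{u} n q) (l : List (Fin n))
    (d : Decision n q) : MeasurableSet {ω : A.Outcome | A.next ω.1 (samplesOf ω.2 l) = d} := by
  have h := A.measurable_next l.length l.get d
  have hm : Measurable (fun ω : A.Outcome =>
      ((ω.1, fun s => ω.2 (l.get s, (l.take s).count (l.get s))) :
        A.Seed × (Fin l.length → ℝ))) := by fun_prop
  exact hm h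

theorem measurableSet_arms_history (A : SamplingAlgorithm.{u} n q) (t : ℕ) (l : List (Fin n)) :
    MeasurableSet {ω : A.Outcome | (A.history ω t).map Prod.fst = l} := by
  induction t generalizing l with
  | zero => simp [history]
  | succ t ih =>
    let step : List (Fin n) → Decision n q → List (Fin n) := fun l d =>
      match d with
      | .pull a => l ++ [a]
      | .halt _ => l
    have heq : {ω : A.Outcome | (A.history ω (t + 1)).map Prod.fst = l} =
        ⋃ l' : List (Fin n), ⋃ d : Decision n q, ⋃ _ : step l' d = l,
          {ω : A.Outcome | (A.history ω t).map Prod.fst = l'} ∩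
            {ω : A.Outcome | A.next ω.1 (samplesOf ω.2 l') = d} := by
      have hstep : ∀ ω : A.Outcome, (A.history ω (t + 1)).map Prod.fst =
          step ((A.history ω t).map Prod.fst) (A.next ω.1 (A.history ω t)) := by
        intro ω
        rw [history]
        split <;> rename_i h <;> simp [h, step]
      ext ω
      simp only [Set.mem_ofPred_eq, Set.mem_iUnion, Set.mem_inter_iff, exists_prop]
      constructor
      · intro h
        refine ⟨_, A.next ω.1 (A.history ω t), ?_, rfl, ?_⟩
        · rw [← hstep, h]
        · rw [← history_eq_samplesOf]
      · rintro ⟨l', d, h1, rfl, h3⟩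
        rw [hstep, ← h1, ← h3, ← history_eq_samplesOf]
    rw [heq]
    exact .iUnion fun l' => .iUnion fun d => .iUnion fun _ =>
      (ih l').inter (A.measurableSet_next_samplesOf l' d)

theorem measurableSet_reports (A : SamplingAlgorithm.{u} n q) (ans : Fin q → Fin n) :
    MeasurableSet {ω : A.Outcome | A.Reports ω ans} := by
  have heq : {ω : A.Outcome | A.Reports ω ans} = ⋃ t : ℕ, ⋃ l : List (Fin n),
      {ω : A.Outcome | (A.history ω t).map Prod.fst = l} ∩
        {ω : A.Outcome | A.next ω.1 (samplesOf ω.2 l) = .halt ans} := by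
    ext ω
    simp only [Reports, Set.mem_ofPred_eq, Set.mem_iUnion, Set.mem_inter_iff]
    refine exists_congr fun t => ?_
    rw [exists_eq_left', ← history_eq_samplesOf]
  rw [heq]
  exact .iUnion fun t => .iUnion fun l =>
    (A.measurableSet_arms_history t l).inter (A.measurableSet_next_samplesOf l _)

/-- The number of samples drawn from arm `a` during the first `t` steps. -/
def pullsUpTo (A : SamplingAlgorithm.{u} n q) (a : Fin n) (t : ℕ) (ω : A.Outcome) : ℕ :=
  ((A.history ω t).map Prod.fst).count a

/-- The total number of samples drawn from arm `a`. -/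
noncomputable def pulls (A : SamplingAlgorithm.{u} n q) (a : Fin n) (ω : A.Outcome) : ℝ≥0∞ :=
  ⨆ t, (A.pullsUpTo a t ω : ℝ≥0∞)

theorem measurable_pullsUpTo (A : SamplingAlgorithm.{u} n q) (a : Fin n) (t : ℕ) :
    Measurable (A.pullsUpTo a t) := by
  refine measurable_to_countable' fun k => ?_
  have heq : A.pullsUpTo a t ⁻¹' {k} = ⋃ l : List (Fin n), ⋃ _ : l.count a = k,
      {ω : A.Outcome | (A.history ω t).map Prod.fst = l} := by
    ext ω
    simp [pullsUpTo]
  rw [heq]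
  exact .iUnion fun l => .iUnion fun _ => A.measurableSet_arms_history t l

theorem measurable_pulls (A : SamplingAlgorithm.{u} n q) (a : Fin n) :
    Measurable (A.pulls a) :=
  .iSup fun t => (measurable_from_top (f := fun k : ℕ => (k : ℝ≥0∞))).comp
    (A.measurable_pullsUpTo a t)

theorem history_succ_of_pull (A : SamplingAlgorithm.{u} n q) {ω : A.Outcome} {t : ℕ} {a : Fin n}
    (h : A.next ω.1 (A.history ω t) = .pull a) :
    A.history ω (t + 1) = A.history ω t ++ [(a, ω.2 (a, A.pullsUpTo a t ω))] := by
  rw [history, h]; rfl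

theorem history_succ_of_halt (A : SamplingAlgorithm.{u} n q) {ω : A.Outcome} {t : ℕ}
    {ans : Fin q → Fin n} (h : A.next ω.1 (A.history ω t) = .halt ans) :
    A.history ω (t + 1) = A.history ω t := by
  rw [history, h]

theorem history_prefix_succ (A : SamplingAlgorithm.{u} n q) (ω : A.Outcome) (t : ℕ) :
    A.history ω t <+: A.history ω (t + 1) := by
  cases h : A.next ω.1 (A.history ω t) with
  | pull a => rw [A.history_succ_of_pull h]; exact List.prefix_append _ _
  | halt ans => rw [A.history_succ_of_halt h]

theorem pullsUpTo_mono (A : SamplingAlgorithm.{u} n q) (a : Fin n) (ω : A.Outcome) :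
    Monotone fun t => A.pullsUpTo a t ω :=
  monotone_nat_of_le_succ fun t =>
    List.Sublist.count_le a ((A.history_prefix_succ ω t).sublist.map Prod.fst)

theorem sum_pulls_le_numSamples (A : SamplingAlgorithm.{u} n q) (ω : A.Outcome) :
    ∑ a, A.pulls a ω ≤ A.numSamples ω := by
  unfold pulls numSamples
  rw [ENNReal.finsetSum_iSup_of_monotone (f := fun a t => (A.pullsUpTo a t ω : ℝ≥0∞))
    (fun a => Nat.mono_cast.comp (A.pullsUpTo_mono a ω))]
  refine iSup_mono fun t => ?_
  rw [← Nat.cast_sum]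
  refine Nat.cast_le.2 (le_of_eq ?_)
  have h := Multiset.sum_count_eq_card (s := Finset.univ)
    (m := (((A.history ω t).map Prod.fst : List (Fin n)) : Multiset (Fin n))) (by simp)
  simpa [pullsUpTo] using h

theorem sum_lintegral_pulls_le {ι : Type*} [Fintype ι] (A : SamplingAlgorithm.{u} n q)
    (ν : Fin n → ProbabilityMeasure ℝ) (arm : ι → Fin n) (harm : Function.Injective arm) :
    ∑ i, ∫⁻ ω, A.pulls (arm i) ω ∂(A.law ν) ≤ A.expectedSamples ν := by
  classical
  rw [← lintegral_finsetSum _ (fun i _ => A.measurable_pulls _)]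
  refine lintegral_mono fun ω => le_trans ?_ (A.sum_pulls_le_numSamples ω)
  rw [← Finset.sum_image (f := fun a => A.pulls a ω) (s := Finset.univ) (g := arm)
    (fun _ _ _ _ h => harm h)]
  exact Finset.sum_le_sum_of_subset (Finset.subset_univ _)

theorem history_eq_of_halt (A : SamplingAlgorithm.{u} n q) {ω : A.Outcome} {t : ℕ}
    {ans : Fin q → Fin n} (h : A.next ω.1 (A.history ω t) = .halt ans) {t' : ℕ} (ht : t ≤ t') :
    A.history ω t' = A.history ω t := by
  induction t', ht using Nat.le_induction with
  | base => rfl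
  | succ k _ ih => rw [← ih] at h; rw [A.history_succ_of_halt h, ih]

theorem reports_unique (A : SamplingAlgorithm.{u} n q) {ω : A.Outcome} {x y : Fin q → Fin n}
    (hx : A.Reports ω x) (hy : A.Reports ω y) : x = y := by
  obtain ⟨t, ht⟩ := hx
  obtain ⟨t', ht'⟩ := hy
  rcases le_total t t' with h | h
  · rw [A.history_eq_of_halt ht h, ht] at ht'
    exact Decision.halt.inj ht'
  · rw [A.history_eq_of_halt ht' h, ht'] at ht
    exact (Decision.halt.inj ht).symm

/-! ### Change of measure in one arm. -/

/-- A run that draws at most `N` samples from arm `a` does not depend on the later samples of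
this arm. -/
theorem history_congr (A : SamplingAlgorithm.{u} n q) {ω ω' : A.Outcome} (a : Fin n) (N : ℕ)
    (h1 : ω'.1 = ω.1) (h2 : ∀ p : Fin n × ℕ, ¬ (p.1 = a ∧ N ≤ p.2) → ω'.2 p = ω.2 p)
    (hN : ∀ t, A.pullsUpTo a t ω ≤ N) (t : ℕ) : A.history ω' t = A.history ω t := by
  induction t with
  | zero => rfl
  | succ t ih =>
    cases h : A.next ω.1 (A.history ω t) with
    | pull b =>
      have h' : A.next ω'.1 (A.history ω' t) = .pull b := by rw [h1, ih, h]
      have hp : A.pullsUpTo b t ω' = A.pullsUpTo b t ω := by rw [pullsUpTo, ih, pullsUpTo]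
      rw [A.history_succ_of_pull h, A.history_succ_of_pull h', ih, hp, h2]
      -- Reading a cell of index at least `N` would make the count of this arm exceed `N` one step
      -- later.
      rintro ⟨rfl, hb⟩
      have := hN (t + 1)
      rw [pullsUpTo, A.history_succ_of_pull h] at this
      simp only [List.map_append, List.map_singleton, List.count_append, List.count_singleton_self]
        at this
      change A.pullsUpTo b t ω + 1 ≤ N at this
      simp only at hb
      omega
    | halt ans =>
      have h' : A.next ω'.1 (A.history ω' t) = .halt ans := by rw [h1, ih, h]
      rw [A.history_succ_of_halt h, A.history_succ_of_halt h', ih]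

/-- The event that `ans` is reported after at most `N` samples of arm `a`. -/
def reportsWithin (A : SamplingAlgorithm.{u} n q) (ans : Fin q → Fin n) (a : Fin n) (N : ℕ) :
    Set A.Outcome :=
  {ω | A.Reports ω ans ∧ ∀ t, A.pullsUpTo a t ω ≤ N}

theorem measurableSet_reportsWithin (A : SamplingAlgorithm.{u} n q) (ans : Fin q → Fin n)
    (a : Fin n) (N : ℕ) : MeasurableSet (A.reportsWithin ans a N) := by
  have heq : A.reportsWithin ans a N =
      {ω | A.Reports ω ans} ∩ ⋂ t, A.pullsUpTo a t ⁻¹' Set.Iic N := by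
    ext ω; simp [reportsWithin]
  rw [heq]
  exact (A.measurableSet_reports ans).inter
    (.iInter fun t => A.measurable_pullsUpTo a t measurableSet_Iic)

theorem reportsWithin_congr (A : SamplingAlgorithm.{u} n q) (ans : Fin q → Fin n) (a : Fin n)
    (N : ℕ) {ω ω' : A.Outcome} (h1 : ω'.1 = ω.1)
    (h2 : ∀ p : Fin n × ℕ, ¬ (p.1 = a ∧ N ≤ p.2) → ω'.2 p = ω.2 p)
    (h : ω ∈ A.reportsWithin ans a N) : ω' ∈ A.reportsWithin ans a N := by
  have hh := A.history_congr a N h1 h2 h.2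
  refine ⟨?_, fun t => ?_⟩
  · obtain ⟨t, ht⟩ := h.1
    exact ⟨t, by rw [h1, hh, ht]⟩
  · rw [pullsUpTo, hh]; exact h.2 t

open Classical in
/-- Overwrite the samples of arm `a` after the first `N` ones. -/
noncomputable def cutCell (a : Fin n) (N : ℕ) (p : Fin n × ℕ) : ℝ → ℝ :=
  if p.1 = a ∧ N ≤ p.2 then fun _ => 0 else id

theorem measurable_cutCell (a : Fin n) (N : ℕ) (p : Fin n × ℕ) : Measurable (cutCell a N p) := by
  unfold cutCell; split_ifs <;> fun_prop

/-- The event ignores the overwritten cells, so it is its own preimage under overwriting. Afterwards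
two laws that differ only in arm `a` differ in `N` cells only, and a finite product density is
available. -/
theorem law_reportsWithin (A : SamplingAlgorithm.{u} n q) (ν : Fin n → ProbabilityMeasure ℝ)
    (ans : Fin q → Fin n) (a : Fin n) (N : ℕ) :
    A.law ν (A.reportsWithin ans a N) = ((A.seedLaw : Measure A.Seed).prod
      (Measure.infinitePi fun p : Fin n × ℕ => (ν p.1 : Measure ℝ).map (cutCell a N p)))
        (A.reportsWithin ans a N) := by
  have hm := measurable_cutCell a N
  have hpi := Measure.infinitePi_map_pi (fun p : Fin n × ℕ => (ν p.1 : Measure ℝ)) hm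
  rw [← hpi]
  conv_rhs => rw [← Measure.map_id (μ := (A.seedLaw : Measure A.Seed))]
  have hm2 : Measurable fun (x : Fin n × ℕ → ℝ) i => cutCell a N i (x i) := by fun_prop
  rw [Measure.map_prod_map _ _ measurable_id hm2,
    Measure.map_apply (measurable_id.prodMap hm2) (A.measurableSet_reportsWithin ans a N)]
  unfold law
  congr 1
  ext ω
  constructor
  · refine A.reportsWithin_congr ans a N rfl (fun p hp => ?_)
    simp [cutCell, hp]
  · refine A.reportsWithin_congr ans a N rfl (fun p hp => ?_)
    simp [cutCell, hp]

theorem law_reportsWithin_sq_le (A : SamplingAlgorithm.{u} n q)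
    (ν ν' : Fin n → ProbabilityMeasure ℝ) (a : Fin n) (hν : ∀ b ≠ a, ν b = ν' b)
    (p r : unitInterval) (hp : ν a = bernoulliReal p) (hr : ν' a = bernoulliReal r)
    (h0 : 0 < (r : ℝ)) (h1 : (r : ℝ) < 1) (ans : Fin q → Fin n) (N : ℕ) :
    (A.law ν (A.reportsWithin ans a N)) ^ 2 ≤ A.law ν' (A.reportsWithin ans a N) *
      ENNReal.ofReal (1 + ((p : ℝ) - r) ^ 2 / (r * (1 - r))) ^ N := by
  classical
  rw [A.law_reportsWithin ν, A.law_reportsWithin ν']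
  have hprob : ∀ (ξ : Fin n → ProbabilityMeasure ℝ) (i : Fin n × ℕ),
      IsProbabilityMeasure ((ξ i.1 : Measure ℝ).map (cutCell a N i)) := fun ξ i =>
    Measure.isProbabilityMeasure_map (measurable_cutCell a N i).aemeasurable
  have := hprob ν
  have := hprob ν'
  set s : Finset (Fin n × ℕ) := {a} ×ˢ Finset.range N with hs
  have hmem : ∀ i ∈ s, i.1 = a ∧ cutCell a N i = id := by
    intro i hi
    simp only [hs, Finset.mem_product, Finset.mem_singleton, Finset.mem_range] at hi
    refine ⟨hi.1, ?_⟩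
    simp [cutCell, hi.2]
  have hfm := measurable_bernoulliDensity p r
  rw [Measure.infinitePi_eq_withDensity
    (fun i : Fin n × ℕ => (ν' i.1 : Measure ℝ).map (cutCell a N i))
    (fun i : Fin n × ℕ => (ν i.1 : Measure ℝ).map (cutCell a N i)) (fun _ => bernoulliDensity p r) (fun _ => hfm) s,
    prod_withDensity_right (by fun_prop)]
  rotate_left
  · intro i hi
    obtain ⟨hi1, hi2⟩ := hmem i hi
    rw [hi2, Measure.map_id, Measure.map_id, hi1, hp, hr, bernoulliReal_eq_withDensity p r h0 h1]
  · intro i hi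
    -- Outside `s`, a cell of arm `a` has been overwritten by `0` under both laws, and the other
    -- arms agree by `hν`.
    by_cases hia : i.1 = a
    · have hc : cutCell a N i = fun _ => 0 := by
        simp only [hs, Finset.mem_product, Finset.mem_singleton, Finset.mem_range, not_and,
          not_lt] at hi
        simp [cutCell, hia, hi hia]
      simp [hc, Measure.map_const]
    · rw [hν _ hia]
  refine (withDensity_sq_le _ _ (by fun_prop)
    (A.measurableSet_reportsWithin ans a N)).trans (le_of_eq ?_)
  congr 1
  rw [(measurePreserving_snd (μ := (A.seedLaw : Measure A.Seed))).lintegral_comp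
    (f := fun y : Fin n × ℕ → ℝ => (∏ i ∈ s, bernoulliDensity p r (y i)) ^ 2) (by fun_prop)]
  simp_rw [← Finset.prod_pow]
  rw [ProbabilityTheory.lintegral_prod_eq_prod_lintegral_of_indepFun s
    (fun i (y : Fin n × ℕ → ℝ) => bernoulliDensity p r (y i) ^ 2)
    (ProbabilityTheory.iIndepFun_infinitePi
      (X := fun _ y => bernoulliDensity p r y ^ 2) (fun _ => by fun_prop)) (fun i => by fun_prop)]
  rw [Finset.prod_congr rfl (g := fun _ =>
    ENNReal.ofReal (1 + ((p : ℝ) - r) ^ 2 / (r * (1 - r)))), Finset.prod_const]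
  · simp [hs]
  intro i hi
  obtain ⟨hi1, hi2⟩ := hmem i hi
  refine ((measurePreserving_eval_infinitePi (fun i : Fin n × ℕ =>
    (ν' i.1 : Measure ℝ).map (cutCell a N i)) i).lintegral_comp
    (f := fun y => bernoulliDensity p r y ^ 2) (by fun_prop)).trans ?_
  rw [hi2, Measure.map_id, hi1, hr, lintegral_bernoulliDensity_sq p r h0 h1]

instance (A : SamplingAlgorithm.{u} n q) (ν : Fin n → ProbabilityMeasure ℝ) :
    IsProbabilityMeasure (A.law ν) := by
  unfold law; infer_instance

/-- Change of measure: an answer that is likely under `ν` is not too unlikely under `ν'` if the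
two differ in one arm only, which is rarely sampled under `ν`. -/
theorem exp_le_law_reports (A : SamplingAlgorithm.{u} n q)
    (ν ν' : Fin n → ProbabilityMeasure ℝ) (a : Fin n) (hν : ∀ b ≠ a, ν b = ν' b)
    (p r : unitInterval) (hp : ν a = bernoulliReal p) (hr : ν' a = bernoulliReal r)
    (h0 : 0 < (r : ℝ)) (h1 : (r : ℝ) < 1) {κ : ℝ} (hκ0 : 0 ≤ κ)
    (hκ : ((p : ℝ) - r) ^ 2 / (r * (1 - r)) ≤ κ) (ans : Fin q → Fin n)
    (hans : 3 / 4 ≤ (A.law ν).real {ω | A.Reports ω ans})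
    (hfin : ∫⁻ ω, A.pulls a ω ∂(A.law ν) ≠ ⊤) :
    1 / 3 * Real.exp (-(6 * κ * (∫⁻ ω, A.pulls a ω ∂(A.law ν)).toReal)) ≤
      (A.law ν').real {ω | A.Reports ω ans} := by
  set e := (∫⁻ ω, A.pulls a ω ∂(A.law ν)).toReal with he
  have he0 : 0 ≤ e := ENNReal.toReal_nonneg
  -- By Markov, more than `6 * e` samples have probability at most `1/6`. This leaves `3/4 - 1/6 =
  -- 7/12` for `E`, and `(7/12)^2 ≥ 1/3`.
  set N := ⌊6 * e⌋₊ with hN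
  have hN1 : 6 * e < N + 1 := Nat.lt_floor_add_one _
  have hN2 : (N : ℝ) ≤ 6 * e := Nat.floor_le (by positivity)
  set E := A.reportsWithin ans a N
  have hmarkov : (A.law ν).real {ω | ((N + 1 : ℕ) : ℝ≥0∞) ≤ A.pulls a ω} ≤ 1 / 6 := by
    have h := mul_meas_ge_le_lintegral (μ := A.law ν) (A.measurable_pulls a) ((N + 1 : ℕ) : ℝ≥0∞)
    have h' := ENNReal.toReal_mono hfin h
    rw [ENNReal.toReal_mul, ENNReal.toReal_natCast, ← he] at h'
    change ((N + 1 : ℕ) : ℝ) * (A.law ν).real {ω | ((N + 1 : ℕ) : ℝ≥0∞) ≤ A.pulls a ω} ≤ e at h'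
    rw [Nat.cast_succ] at h'
    have hN3 : (0 : ℝ) < N + 1 := by positivity
    by_contra hc
    push Not at hc
    nlinarith
  have hsub : {ω | A.Reports ω ans} ⊆ E ∪ {ω | ((N + 1 : ℕ) : ℝ≥0∞) ≤ A.pulls a ω} := by
    intro ω hω
    by_cases hc : ∀ t, A.pullsUpTo a t ω ≤ N
    · exact Or.inl ⟨hω, hc⟩
    · push Not at hc
      obtain ⟨t, ht⟩ := hc
      refine Or.inr ?_
      exact (Nat.cast_le.2 ht).trans (le_iSup (fun t => (A.pullsUpTo a t ω : ℝ≥0∞)) t)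
  have hE : 7 / 12 ≤ (A.law ν).real E := by
    have h2 := (measureReal_mono (μ := A.law ν) hsub).trans (measureReal_union_le _ _)
    linarith
  have hsq := A.law_reportsWithin_sq_le ν ν' a hν p r hp hr h0 h1 ans N
  set χ := ((p : ℝ) - r) ^ 2 / (r * (1 - r)) with hχ
  have hχ0 : 0 ≤ χ := div_nonneg (sq_nonneg _) (mul_nonneg h0.le (by linarith))
  have hsq' := ENNReal.toReal_mono (ENNReal.mul_ne_top (measure_ne_top _ _)
    (ENNReal.pow_ne_top ENNReal.ofReal_ne_top)) hsq
  rw [ENNReal.toReal_pow, ENNReal.toReal_mul, ENNReal.toReal_pow,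
    ENNReal.toReal_ofReal (by linarith)] at hsq'
  change (A.law ν).real E ^ 2 ≤ (A.law ν').real E * (1 + χ) ^ N at hsq'
  have hpow : (1 + χ) ^ N ≤ Real.exp (6 * κ * e) := by
    calc (1 + χ) ^ N ≤ Real.exp κ ^ N := by
          refine pow_le_pow_left₀ (by linarith) ?_ N
          linarith [Real.add_one_le_exp κ]
      _ = Real.exp (N * κ) := by rw [← Real.exp_nat_mul]
      _ ≤ Real.exp (6 * κ * e) := by
          refine Real.exp_le_exp.2 ?_
          nlinarith
  have hEle : (A.law ν').real E ≤ (A.law ν').real {ω | A.Reports ω ans} :=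
    measureReal_mono (fun ω hω => hω.1)
  have h3 : 1 / 3 ≤ (A.law ν').real E * Real.exp (6 * κ * e) := by
    have := mul_le_mul_of_nonneg_left hpow (measureReal_nonneg (μ := A.law ν') (s := E))
    nlinarith
  rw [Real.exp_neg, ← div_eq_mul_inv, div_le_iff₀ (Real.exp_pos _)]
  exact h3.trans (mul_le_mul_of_nonneg_right hEle (Real.exp_pos _).le)

end SamplingAlgorithm

/-! ### The staircase instance and its hitting number. -/

/-- There are `τ` blocks of `m` groups of arms; the arms of group `g` sit at the point `g`, and the
`g`-th interval contains the groups of the block of `g` up to `g` itself. -/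
noncomputable def stairInstance (τ m n : ℕ) (hn : τ * m ≤ n) : RangeInstance n (τ * m) where
  point a := ((a.1 % (τ * m) : ℕ) : ℝ)
  left g := ((g.1 / m * m : ℕ) : ℝ) - 1 / 2
  right g := (g.1 : ℝ)
  left_lt_right g := by
    have : ((g.1 / m * m : ℕ) : ℝ) ≤ g.1 := Nat.cast_le.2 (Nat.div_mul_le_self _ _)
    linarith
  exists_arm g := by
    have : ((g.1 / m * m : ℕ) : ℝ) ≤ g.1 := Nat.cast_le.2 (Nat.div_mul_le_self _ _)
    refine ⟨⟨g.1, g.2.trans_le hn⟩, ?_⟩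
    simp only [Nat.mod_eq_of_lt g.2]
    exact ⟨by linarith, le_rfl⟩

theorem mem_armsIn_stairInstance {τ m n : ℕ} (hn : τ * m ≤ n) (g : Fin (τ * m)) (a : Fin n) :
    a ∈ (stairInstance τ m n hn).armsIn g ↔
      g.1 / m * m ≤ a.1 % (τ * m) ∧ a.1 % (τ * m) ≤ g.1 := by
  simp only [RangeInstance.armsIn, stairInstance, Set.mem_ofPred_eq, Nat.cast_le]
  refine and_congr_left fun _ => ⟨fun h => ?_, fun h => ?_⟩
  · have h2 : ((g.1 / m * m : ℕ) : ℝ) < ((a.1 % (τ * m) + 1 : ℕ) : ℝ) := by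
      rw [Nat.cast_succ]; linarith
    exact Nat.lt_succ_iff.1 (Nat.cast_lt.1 h2)
  · have : ((g.1 / m * m : ℕ) : ℝ) ≤ ((a.1 % (τ * m) : ℕ) : ℝ) := Nat.cast_le.2 h
    linarith

/-- One point just left of the first group of a block hits all intervals of that block. Conversely,
the shortest intervals of the blocks, `[t * m - 1/2, t * m]`, are pairwise disjoint. -/
theorem optimalHittingSetSize_stairInstance {τ m n : ℕ} (hm : 1 ≤ m) (hn : τ * m ≤ n) :
    (stairInstance τ m n hn).OptimalHittingSetSize τ := by
  have hinj : Function.Injective fun t : ℕ => ((t * m : ℕ) : ℝ) - 1 / 4 := by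
    intro s t hst
    have : ((s * m : ℕ) : ℝ) = ((t * m : ℕ) : ℝ) := by simpa using hst
    exact Nat.eq_of_mul_eq_mul_right hm (Nat.cast_injective this)
  constructor
  · refine ⟨(Finset.range τ).image fun t : ℕ => ((t * m : ℕ) : ℝ) - 1 / 4, fun g => ?_, ?_⟩
    · refine ⟨((g.1 / m * m : ℕ) : ℝ) - 1 / 4, Finset.mem_image.2 ⟨g.1 / m, ?_, rfl⟩, ?_, ?_⟩
      · exact Finset.mem_range.2 (Nat.div_lt_of_lt_mul (g.2.trans_eq (mul_comm _ _)))
      · simp only [stairInstance]; linarith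
      · have : ((g.1 / m * m : ℕ) : ℝ) ≤ g.1 := Nat.cast_le.2 (Nat.div_mul_le_self _ _)
        simp only [stairInstance]; linarith
    · rw [Finset.card_image_of_injective _ hinj, Finset.card_range]
  · rintro k ⟨H, hH, rfl⟩
    have hg : ∀ t : Fin τ, t.1 * m < τ * m := fun t => Nat.mul_lt_mul_of_pos_right t.2 hm
    choose e heH hel her using fun t : Fin τ => hH ⟨t.1 * m, hg t⟩
    simp only [stairInstance, Nat.mul_div_cancel _ hm] at hel her
    have hlt : ∀ s t : Fin τ, s < t → e s < e t := by
      intro s t hst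
      have h1 : s.1 * m + 1 ≤ t.1 * m := Nat.mul_lt_mul_of_pos_right hst hm
      have h2 : ((s.1 * m : ℕ) : ℝ) + 1 ≤ ((t.1 * m : ℕ) : ℝ) := by exact_mod_cast h1
      have := hel t
      have := her s
      linarith
    have hmono : StrictMono e := hlt
    have := Finset.card_le_card_of_injOn (s := Finset.univ) (t := H) e (fun t _ => heH t)
      hmono.injective.injOn
    simpa using this

/-! ### Hard weights on the staircase. -/

section Stair

variable {K M n : ℕ}

/-- The arm of group `g` that serves as the reference of this group. -/
def refArm (hn : K * (M + 1) ≤ n) (g : Fin K) : Fin n :=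
  ⟨g.1, by have := g.2; nlinarith⟩

/-- The `i`-th arm of group `g` besides the reference. -/
def candArm (hn : K * (M + 1) ≤ n) (g : Fin K) (i : Fin M) : Fin n :=
  ⟨g.1 + K * (i.1 + 1), by
    have h1 := g.2
    have h2 : K * (i.1 + 2) ≤ K * (M + 1) := Nat.mul_le_mul_left _ (by have := i.2; omega)
    have h3 : K * (i.1 + 2) = K * (i.1 + 1) + K := by ring
    omega⟩

theorem refArm_mod (hn : K * (M + 1) ≤ n) (g : Fin K) : (refArm hn g).1 % K = g :=
  Nat.mod_eq_of_lt g.2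

theorem refArm_div (hn : K * (M + 1) ≤ n) (g : Fin K) : (refArm hn g).1 / K = 0 :=
  Nat.div_eq_of_lt g.2

theorem candArm_mod (hn : K * (M + 1) ≤ n) (g : Fin K) (i : Fin M) :
    (candArm hn g i).1 % K = g := by
  rw [candArm, Nat.add_mul_mod_self_left, Nat.mod_eq_of_lt g.2]

theorem candArm_div (hn : K * (M + 1) ≤ n) (g : Fin K) (i : Fin M) :
    (candArm hn g i).1 / K = i + 1 := by
  rw [candArm, Nat.add_mul_div_left _ _ (by have := g.2; omega), Nat.div_eq_of_lt g.2, zero_add]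

theorem Fin.ext_mod_div {a b : Fin n} (h1 : a.1 % K = b.1 % K) (h2 : a.1 / K = b.1 / K) :
    a = b := by
  rw [Fin.ext_iff, ← Nat.mod_add_div a.1 K, ← Nat.mod_add_div b.1 K, h1, h2]

theorem candArm_injective (hn : K * (M + 1) ≤ n) :
    Function.Injective fun p : Fin K × Fin M => candArm hn p.1 p.2 := by
  rintro ⟨g, i⟩ ⟨g', i'⟩ h
  have h' : candArm hn g i = candArm hn g' i' := h
  have h1 := candArm_mod hn g i
  have h2 := candArm_div hn g i
  rw [h', candArm_mod] at h1
  rw [h', candArm_div] at h2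
  simp only [Prod.mk.injEq, Fin.ext_iff]
  omega

/-- The arm with the highest weight of each group, when the `c g`-th candidate is raised in the
groups `g` of `S`. -/
def bestArm (hn : K * (M + 1) ≤ n) (S : Fin K → Bool) (c : Fin K → Fin M) (g : Fin K) : Fin n :=
  if S g then candArm hn g (c g) else refArm hn g

/-- With group `g` reset to its reference, `c g` is irrelevant: a single wrong answer serves every
raised candidate `i`. -/
theorem bestArm_update_true (hn : K * (M + 1) ≤ n) (S : Fin K → Bool) (c : Fin K → Fin M)
    (g : Fin K) (i : Fin M) :
    bestArm hn (Function.update S g false) (Function.update c g i) =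
      bestArm hn (Function.update S g false) c := by
  funext g'
  by_cases h : g' = g
  · subst h; simp [bestArm]
  · simp [bestArm, h]

theorem bestArm_apply_mod (hn : K * (M + 1) ≤ n) (S : Fin K → Bool) (c : Fin K → Fin M)
    (g : Fin K) : (bestArm hn S c g).1 % K = g := by
  unfold bestArm; split_ifs
  · exact candArm_mod hn _ _
  · exact refArm_mod hn _

/-- The two answers already differ at `g`. This separates a reset answer both from the correct one
and from the answers with another group reset. -/
theorem bestArm_update_false_ne (hn : K * (M + 1) ≤ n) (S : Fin K → Bool) (c : Fin K → Fin M)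
    {g : Fin K} {S' : Fin K → Bool} (hg : S' g = true) :
    bestArm hn (Function.update S g false) c ≠ bestArm hn S' c := by
  intro h
  have h1 := congrFun h g
  simp only [bestArm, Function.update_self, hg, if_true, Bool.false_eq_true, if_false] at h1
  have h2 := refArm_div hn g
  rw [h1, candArm_div] at h2
  omega

/-- The weights of the arms, when the `c g`-th candidate is raised in the groups `g` of `S`. -/
noncomputable def stairMean (ε : ℝ) (m : ℕ) (S : Fin K → Bool) (c : Fin K → Fin M) (a : Fin n) :
    ℝ :=
  1 / 4 + 4 * ε * ((a.1 % K % m : ℕ) : ℝ) +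
    if a.1 / K = 0 then 2 * ε
    else if ∃ g : Fin K, g.1 = a.1 % K ∧ S g = true ∧ a.1 / K = (c g).1 + 1 then 4 * ε else 0

variable {ε : ℝ} {m : ℕ}

theorem stairMean_refArm (hn : K * (M + 1) ≤ n) (S : Fin K → Bool) (c : Fin K → Fin M)
    (g : Fin K) : stairMean ε m S c (refArm hn g) =
      1 / 4 + 4 * ε * ((g.1 % m : ℕ) : ℝ) + 2 * ε := by
  rw [stairMean, refArm_mod, refArm_div, if_pos rfl]

theorem stairMean_candArm (hn : K * (M + 1) ≤ n) (S : Fin K → Bool) (c : Fin K → Fin M)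
    (g : Fin K) (i : Fin M) : stairMean ε m S c (candArm hn g i) =
      1 / 4 + 4 * ε * ((g.1 % m : ℕ) : ℝ) + if S g = true ∧ i = c g then 4 * ε else 0 := by
  rw [stairMean, candArm_mod, candArm_div, if_neg (by omega)]
  congr 1
  refine if_congr ⟨?_, ?_⟩ rfl rfl
  · rintro ⟨g', h1, h2, h3⟩
    obtain rfl : g' = g := Fin.ext h1
    exact ⟨h2, Fin.ext (by omega)⟩
  · rintro ⟨h1, h2⟩
    exact ⟨g, rfl, h1, by rw [h2]⟩

theorem stairMean_update (hn : K * (M + 1) ≤ n) (S : Fin K → Bool) (c : Fin K → Fin M)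
    (g : Fin K) (i : Fin M) {a : Fin n} (ha : a ≠ candArm hn g i) :
    stairMean ε m (Function.update S g false) c a =
      stairMean ε m (Function.update S g true) (Function.update c g i) a := by
  unfold stairMean
  congr 2
  refine if_congr (exists_congr fun g' => ?_) rfl rfl
  by_cases h : g' = g
  · subst h
    simp only [Function.update_self, Bool.false_eq_true, false_and, and_false, true_and,
      false_iff, not_and]
    intro h1 h2
    refine ha (Fin.ext_mod_div (K := K) ?_ ?_)
    · rw [← h1, candArm_mod]
    · rw [h2, candArm_div]
  · simp [h]

theorem stairMean_mem_Icc (hε : 0 ≤ ε) (hm : 1 ≤ m) (hmε : 8 * ε * m ≤ 1) (S : Fin K → Bool)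
    (c : Fin K → Fin M) (a : Fin n) : stairMean ε m S c a ∈ Set.Icc (1 / 4 : ℝ) (3 / 4) := by
  have h1 : ((a.1 % K % m : ℕ) : ℝ) + 1 ≤ m := by exact_mod_cast Nat.mod_lt (a.1 % K) hm
  have h2 : (0 : ℝ) ≤ ((a.1 % K % m : ℕ) : ℝ) := Nat.cast_nonneg _
  have h3 := mul_le_mul_of_nonneg_left h1 hε
  have h4 := mul_nonneg hε h2
  unfold stairMean
  split_ifs <;> constructor <;> linarith

/-- An arm of an earlier group, even if raised, only reaches the base of group `g`, at least `2ε`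
below the best arm. Within group `g` the levels `0`, `2ε`, `4ε` are `2ε` apart, and the top one is
attained once. Leftover arms beyond the candidates count as unraised. -/
theorem eq_bestArm_of_isEpsOptimal {τ : ℕ} (hε : 0 < ε) (hK : τ * m ≤ n)
    (hn : τ * m * (M + 1) ≤ n) (S : Fin (τ * m) → Bool) (c : Fin (τ * m) → Fin M)
    (g : Fin (τ * m)) (b : Fin n)
    (hb : (stairInstance τ m n hK).IsEpsOptimal (stairMean ε m S c) ε g b) :
    b = bestArm hn S c g := by
  obtain ⟨hmem, hopt⟩ := hb
  have h := hopt (bestArm hn S c g) (by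
    rw [mem_armsIn_stairInstance, bestArm_apply_mod]
    exact ⟨Nat.div_mul_le_self _ _, le_rfl⟩)
  rw [mem_armsIn_stairInstance] at hmem
  have hbest : stairMean ε m S c (bestArm hn S c g) =
      1 / 4 + 4 * ε * ((g.1 % m : ℕ) : ℝ) + if S g = true then 4 * ε else 2 * ε := by
    unfold bestArm
    split_ifs with hS
    · rw [stairMean_candArm, if_pos ⟨hS, rfl⟩]
    · rw [stairMean_refArm]
  rw [hbest] at h
  rcases hmem.2.lt_or_eq with hlt | heq
  · exfalso
    have hmod : b.1 % (τ * m) % m + 1 ≤ g.1 % m := by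
      have hg := Nat.mod_add_div g.1 m
      have hd : b.1 % (τ * m) / m = g.1 / m := by
        refine le_antisymm (Nat.div_le_div_right hlt.le) ?_
        have hmpos : 0 < m := by
          rcases Nat.eq_zero_or_pos m with h0 | h0
          · subst h0; exact absurd g.2 (by simp)
          · exact h0
        exact (Nat.le_div_iff_mul_le hmpos).2 hmem.1
      have hb := Nat.mod_add_div (b.1 % (τ * m)) m
      rw [hd] at hb
      omega
    have hmod' : ((b.1 % (τ * m) % m : ℕ) : ℝ) + 1 ≤ ((g.1 % m : ℕ) : ℝ) := by
      exact_mod_cast hmod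
    have h2 := mul_le_mul_of_nonneg_left hmod' hε.le
    unfold stairMean at h
    split_ifs at h <;> linarith
  · have hdiv : b.1 / (τ * m) = (bestArm hn S c g).1 / (τ * m) := by
      unfold stairMean at h
      rw [heq] at h
      unfold bestArm
      by_cases h0 : b.1 / (τ * m) = 0
      · rw [if_pos h0] at h
        split_ifs with hS
        · rw [if_pos hS] at h; linarith
        · rw [h0, refArm_div]
      · rw [if_neg h0] at h
        by_cases h1 : ∃ g' : Fin (τ * m), g'.1 = g.1 ∧ S g' = true ∧
            b.1 / (τ * m) = (c g').1 + 1
        · obtain ⟨g', hg', h2, h3⟩ := h1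
          obtain rfl : g' = g := Fin.ext hg'
          rw [if_pos h2, candArm_div, h3]
        · rw [if_neg h1] at h
          split_ifs at h <;> linarith
    exact Fin.ext_mod_div (by rw [heq, bestArm_apply_mod]) hdiv

/-- Bernoulli arms with the weights `stairMean`. -/
noncomputable def stairLaw (ε : ℝ) (m : ℕ) (S : Fin K → Bool) (c : Fin K → Fin M) (a : Fin n) :
    ProbabilityMeasure ℝ :=
  bernoulliReal (Set.projIcc 0 1 zero_le_one (stairMean ε m S c a))

theorem supportedOnUnit_stairLaw (S : Fin K → Bool) (c : Fin K → Fin M) :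
    SupportedOnUnit (stairLaw (n := n) ε m S c) :=
  fun _ => bernoulliReal_Icc _

theorem coe_projIcc_stairMean (hε : 0 ≤ ε) (hm : 1 ≤ m) (hmε : 8 * ε * m ≤ 1) (S : Fin K → Bool)
    (c : Fin K → Fin M) (a : Fin n) :
    (Set.projIcc (0 : ℝ) 1 zero_le_one (stairMean ε m S c a) : ℝ) = stairMean ε m S c a := by
  have h := stairMean_mem_Icc hε hm hmε S c a
  rw [Set.projIcc_of_mem _ ⟨by linarith [h.1], by linarith [h.2]⟩]

theorem weight_stairLaw (hε : 0 ≤ ε) (hm : 1 ≤ m) (hmε : 8 * ε * m ≤ 1) (S : Fin K → Bool)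
    (c : Fin K → Fin M) : weight (n := n) (stairLaw ε m S c) = stairMean ε m S c := by
  funext a
  rw [weight, stairLaw, integral_bernoulliReal, coe_projIcc_stairMean hε hm hmε]

end Stair

/-! ### Averaging over the hidden configuration. -/

/-- Exchanging `x g` with `b` is an involution on the pairs `(x, b)`. -/
theorem sum_sum_update {ι α : Type*} [Fintype ι] [DecidableEq ι] [Fintype α] (g : ι)
    (f : (ι → α) → ℝ) :
    ∑ x : ι → α, ∑ b : α, f (Function.update x g b) = Fintype.card α * ∑ x, f x := by
  let e : (ι → α) × α → (ι → α) × α := fun p => (Function.update p.1 g p.2, p.1 g)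
  have he : Function.Involutive e := fun p => by simp [e]
  have h := Equiv.sum_comp he.toPerm (fun p : (ι → α) × α => f p.1)
  rw [Fintype.sum_prod_type, Fintype.sum_prod_type] at h
  simp only [Function.Involutive.coe_toPerm, e] at h
  rw [h, Finset.mul_sum]
  simp

theorem sum_update_bool {ι : Type*} [Fintype ι] [DecidableEq ι] (g : ι) (b : Bool)
    (f : (ι → Bool) → ℝ) :
    ∑ x : ι → Bool, f (Function.update x g b) = 2 * ∑ x, if x g = b then f x else 0 := by
  have h := sum_sum_update g (fun x : ι → Bool => if x g = b then f x else 0)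
  rw [Fintype.card_bool] at h
  push_cast at h
  rw [← h]
  refine Finset.sum_congr rfl fun x _ => ?_
  cases b <;> simp

/-- The direct-sum argument: exponential lower bounds for the error probabilities `φ` of `K`
simultaneous tasks whose errors exclude each other. -/
theorem exp_le_of_sum_le {K M : ℕ} (hK : 1 ≤ K) (hM : 1 ≤ M) {C V δ : ℝ} (hC : 0 ≤ C)
    (φ : Fin K → (Fin K → Bool) → (Fin K → Fin M) → ℝ)
    (T : (Fin K → Bool) → (Fin K → Fin M) → Fin K → Fin M → ℝ)
    (hφ : ∀ g S c, 0 ≤ φ g S c) (hT : ∀ S c g i, 0 ≤ T S c g i)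
    (h1 : ∀ S c g i, 1 / 3 * Real.exp (-(C * T (Function.update S g false) c g i)) ≤
      φ g (Function.update S g true) (Function.update c g i))
    (h2 : ∀ S c, ∑ g, (if S g = true then φ g S c else 0) ≤ δ)
    (h3 : ∀ S c, ∑ g, ∑ i, T S c g i ≤ V) :
    1 / 3 * Real.exp (-(C * (2 * V / (K * M)))) ≤ δ ∧
      1 / 3 * Real.exp (-(C * (2 * V / (K * M)))) ≤ 2 * δ / K := by
  set y : ℝ := 2 * V / (K * M) with hy
  set E := Real.exp (-(C * y)) with hE
  have hE0 : 0 < E := Real.exp_pos _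
  have hK' : (0 : ℝ) < K := Nat.cast_pos.2 hK
  have hM' : (0 : ℝ) < M := Nat.cast_pos.2 hM
  have : NeZero M := ⟨by omega⟩
  set D : ℝ := (Fintype.card (Fin K → Bool) : ℝ) * Fintype.card (Fin K → Fin M) with hD
  have hD0 : 0 < D := mul_pos (Nat.cast_pos.2 Fintype.card_pos) (Nat.cast_pos.2 Fintype.card_pos)
  set Φ := ∑ g, ∑ S, ∑ c, ∑ i, φ g (Function.update S g true) (Function.update c g i) with hΦ
  -- Each `S` without `g` arises from two sets when `g` is removed, whence the factor `2`.
  have hTsum : ∑ g, ∑ S, ∑ c, ∑ i, T (Function.update S g false) c g i ≤ 2 * (D * V) := by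
    have hg : ∀ g, ∑ S, ∑ c, ∑ i, T (Function.update S g false) c g i ≤
        2 * ∑ S, ∑ c, ∑ i, T S c g i := by
      intro g
      rw [sum_update_bool g false (fun S => ∑ c, ∑ i, T S c g i)]
      refine mul_le_mul_of_nonneg_left (Finset.sum_le_sum fun S _ => ?_) zero_le_two
      split_ifs
      · exact le_rfl
      · exact Finset.sum_nonneg fun c _ => Finset.sum_nonneg fun i _ => hT _ _ _ _
    refine (Finset.sum_le_sum fun g _ => hg g).trans ?_
    rw [← Finset.mul_sum, Finset.sum_comm]
    refine mul_le_mul_of_nonneg_left ?_ zero_le_two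
    calc ∑ S, ∑ g, ∑ c, ∑ i, T S c g i = ∑ S, ∑ c, ∑ g, ∑ i, T S c g i :=
          Finset.sum_congr rfl fun S _ => Finset.sum_comm
      _ ≤ ∑ _S : Fin K → Bool, ∑ _c : Fin K → Fin M, V :=
          Finset.sum_le_sum fun S _ => Finset.sum_le_sum fun c _ => h3 S c
      _ = D * V := by
          simp only [Finset.sum_const, Finset.card_univ, nsmul_eq_mul, hD]; ring
  have hlow : K * D * M * (1 / 3 * E) ≤ Φ := by
    -- Jensen by hand: the tangent of `t ↦ exp(-(C * t))` at `y` lies below the curve. It is linear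
    -- in `t`, so the bound on the sum of `T` suffices.
    have hpt : ∀ g S c i, 1 / 3 * E * (1 + C * y) +
        -(1 / 3 * E * C) * T (Function.update S g false) c g i ≤
          φ g (Function.update S g true) (Function.update c g i) := by
      intro g S c i
      refine le_trans ?_ (h1 S c g i)
      set t := T (Function.update S g false) c g i
      have := Real.add_one_le_exp (-(C * t) + C * y)
      rw [Real.exp_add] at this
      have hEy : E * Real.exp (C * y) = 1 := by rw [hE, ← Real.exp_add]; simp
      have h4 := mul_le_mul_of_nonneg_left this hE0.le
      have h5 : E * (Real.exp (-(C * t)) * Real.exp (C * y)) = Real.exp (-(C * t)) := by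
        rw [mul_left_comm, hEy, mul_one]
      rw [h5] at h4
      linarith
    have hsum := Finset.sum_le_sum fun g (_ : g ∈ Finset.univ) =>
      Finset.sum_le_sum fun S (_ : S ∈ Finset.univ) =>
        Finset.sum_le_sum fun c (_ : c ∈ Finset.univ) =>
          Finset.sum_le_sum fun i (_ : i ∈ Finset.univ) => hpt g S c i
    simp only [Finset.sum_add_distrib, ← Finset.mul_sum, Finset.sum_const, Finset.card_univ,
      nsmul_eq_mul] at hsum
    rw [← hΦ] at hsum
    have hc : 0 ≤ 1 / 3 * E * C := by positivity
    have h6 := mul_le_mul_of_nonneg_left hTsum hc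
    have h7 : (K : ℝ) * M * y = 2 * V := by rw [hy]; field_simp
    refine le_trans ?_ hsum
    rw [Fintype.card_fin, Fintype.card_fin]
    have h8 : 1 / 3 * E * (M * ((Fintype.card (Fin K → Fin M) : ℝ) *
        (Fintype.card (Fin K → Bool) * (K * 1))) + C * (M * (Fintype.card (Fin K → Fin M) *
          (Fintype.card (Fin K → Bool) * (K * y))))) =
        K * D * M * (1 / 3 * E) + 1 / 3 * E * C * (D * (K * M * y)) := by rw [hD]; ring
    rw [h8, h7]
    linarith
  have hΦ' : Φ = M * ∑ g, ∑ S, ∑ c, φ g (Function.update S g true) c := by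
    rw [hΦ, Finset.mul_sum]
    refine Finset.sum_congr rfl fun g _ => ?_
    rw [Finset.mul_sum]
    refine Finset.sum_congr rfl fun S _ => ?_
    rw [sum_sum_update g (fun c => φ g (Function.update S g true) c), Fintype.card_fin]
  constructor
  · have hone : ∀ g S c, φ g (Function.update S g true) c ≤ δ := by
      intro g S c
      refine le_trans ?_ (h2 (Function.update S g true) c)
      have := Finset.single_le_sum (f := fun g' => if Function.update S g true g' = true then
        φ g' (Function.update S g true) c else 0) (fun g' _ => by split_ifs <;> simp [hφ])
        (Finset.mem_univ g)
      simpa using this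
    have hup : Φ ≤ K * D * M * δ := by
      rw [hΦ']
      have : ∑ g, ∑ S, ∑ c, φ g (Function.update S g true) c ≤
          ∑ _g : Fin K, ∑ _S : Fin K → Bool, ∑ _c : Fin K → Fin M, δ :=
        Finset.sum_le_sum fun g _ => Finset.sum_le_sum fun S _ => Finset.sum_le_sum fun c _ =>
          hone g S c
      simp only [Finset.sum_const, Finset.card_univ, nsmul_eq_mul] at this
      rw [Fintype.card_fin] at this
      have := mul_le_mul_of_nonneg_left this hM'.le
      refine this.trans (le_of_eq ?_)
      rw [hD]; ring
    exact le_of_mul_le_mul_left (hlow.trans hup) (by positivity)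
  · have hup : Φ ≤ D * M * (2 * δ) := by
      have hg : ∀ g, ∑ S, ∑ c, φ g (Function.update S g true) c =
          2 * ∑ S, ∑ c, if S g = true then φ g S c else 0 := by
        intro g
        rw [sum_update_bool g true (fun S => ∑ c, φ g S c)]
        congr 1
        refine Finset.sum_congr rfl fun S _ => ?_
        split_ifs <;> simp
      have hle : ∑ g, ∑ S, ∑ c, (if S g = true then φ g S c else 0) ≤ D * δ := by
        rw [Finset.sum_comm]
        calc ∑ S, ∑ g, ∑ c, (if S g = true then φ g S c else 0)
            = ∑ S, ∑ c, ∑ g, (if S g = true then φ g S c else 0) :=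
              Finset.sum_congr rfl fun S _ => Finset.sum_comm
          _ ≤ ∑ _S : Fin K → Bool, ∑ _c : Fin K → Fin M, δ :=
              Finset.sum_le_sum fun S _ => Finset.sum_le_sum fun c _ => h2 S c
          _ = D * δ := by
              simp only [Finset.sum_const, Finset.card_univ, nsmul_eq_mul, hD]; ring
      rw [hΦ', Finset.sum_congr rfl fun g _ => hg g, ← Finset.mul_sum]
      have := mul_le_mul_of_nonneg_left hle hM'.le
      linarith
    rw [le_div_iff₀ hK']
    refine le_of_mul_le_mul_left ?_ (mul_pos hD0 hM')
    linarith

/-! ### The lower bound on the staircase. -/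

namespace SamplingAlgorithm

variable {n q : ℕ}

theorem law_real_reports_ge (A : SamplingAlgorithm.{u} n q) {R : RangeInstance n q} {ε δ : ℝ}
    (hA : A.IsPAC R ε δ) {ν : Fin n → ProbabilityMeasure ℝ} (hν : SupportedOnUnit ν)
    {x : Fin q → Fin n} (hx : ∀ i b, R.IsEpsOptimal (weight ν) ε i b → b = x i) :
    1 - δ ≤ (A.law ν).real {ω | A.Reports ω x} := by
  have h := (hA ν hν).trans (measure_mono (t := {ω | A.Reports ω x}) (by
    rintro ω ⟨ans, h1, h2⟩
    obtain rfl : ans = x := funext fun i => hx i _ (h2 i)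
    exact h1))
  rw [← ofReal_measureReal] at h
  exact (ENNReal.ofReal_le_ofReal_iff measureReal_nonneg).1 h

theorem sum_law_real_reports_le (A : SamplingAlgorithm.{u} n q)
    (ν : Fin n → ProbabilityMeasure ℝ) {ι : Type*} (s : Finset ι) (x : Fin q → Fin n)
    (y : ι → Fin q → Fin n) (hy : ∀ i ∈ s, ∀ j ∈ s, i ≠ j → y i ≠ y j)
    (hxy : ∀ i ∈ s, y i ≠ x) :
    ∑ i ∈ s, (A.law ν).real {ω | A.Reports ω (y i)} ≤ 1 - (A.law ν).real {ω | A.Reports ω x} := by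
  have hdis : Disjoint (⋃ i ∈ s, {ω : A.Outcome | A.Reports ω (y i)})
      {ω : A.Outcome | A.Reports ω x} := by
    simp only [Set.disjoint_iUnion_left]
    refine fun i hi => Set.disjoint_left.2 fun ω h1 h2 => ?_
    exact hxy i hi (A.reports_unique h1 h2)
  have hpair : Set.PairwiseDisjoint (s : Set ι) fun i => {ω : A.Outcome | A.Reports ω (y i)} := by
    intro i hi j hj hij
    refine Set.disjoint_left.2 fun ω h1 h2 => ?_
    exact hy i hi j hj hij (A.reports_unique h1 h2)
  have h1 := measureReal_union (μ := A.law ν) hdis (A.measurableSet_reports x)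
    (measure_ne_top _ _) (measure_ne_top _ _)
  rw [measureReal_biUnion_finset hpair (fun i _ => A.measurableSet_reports (y i))] at h1
  have h2 : (A.law ν).real ((⋃ i ∈ s, {ω : A.Outcome | A.Reports ω (y i)}) ∪
      {ω : A.Outcome | A.Reports ω x}) ≤ 1 := measureReal_le_one
  linarith

/-- The lower bound for the expected number of samples on the staircase instance. -/
theorem exp_le_of_isPAC_stairInstance {τ m M : ℕ} {ε δ V : ℝ} (hτ : 1 ≤ τ) (hm : 1 ≤ m)
    (hM : 1 ≤ M) (hK : τ * m ≤ n) (hn : τ * m * (M + 1) ≤ n) (hε : 0 < ε)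
    (hmε : 8 * ε * m ≤ 1) (hδ : δ ≤ 1 / 4) (hV : 0 ≤ V)
    (A : SamplingAlgorithm.{u} n (τ * m)) (hA : A.IsPAC (stairInstance τ m n hK) ε δ)
    (hAV : ∀ (S : Fin (τ * m) → Bool) (c : Fin (τ * m) → Fin M),
      A.expectedSamples (stairLaw ε m S c) ≤ ENNReal.ofReal V) :
    1 / 3 * Real.exp (-(6 * (86 * ε ^ 2) * (2 * V / ((τ * m : ℕ) * M)))) ≤ δ ∧
      1 / 3 * Real.exp (-(6 * (86 * ε ^ 2) * (2 * V / ((τ * m : ℕ) * M)))) ≤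
        2 * δ / (τ * m : ℕ) := by
  have hgood : ∀ (S : Fin (τ * m) → Bool) (c : Fin (τ * m) → Fin M),
      1 - δ ≤ (A.law (stairLaw ε m S c)).real {ω | A.Reports ω (bestArm hn S c)} := by
    intro S c
    refine A.law_real_reports_ge hA (supportedOnUnit_stairLaw S c) fun g b hb => ?_
    rw [weight_stairLaw hε.le hm hmε] at hb
    exact eq_bestArm_of_isEpsOptimal hε hK hn S c g b hb
  have hsum : ∀ (S : Fin (τ * m) → Bool) (c : Fin (τ * m) → Fin M),
      ∑ g, ∑ i, ∫⁻ ω, A.pulls (candArm hn g i) ω ∂(A.law (stairLaw ε m S c)) ≤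
        ENNReal.ofReal V := by
    intro S c
    refine le_trans ?_ (hAV S c)
    rw [← Fintype.sum_prod_type' (f := fun g i =>
      ∫⁻ ω, A.pulls (candArm hn g i) ω ∂(A.law (stairLaw ε m S c)))]
    exact A.sum_lintegral_pulls_le _ _ (candArm_injective hn)
  have hfin : ∀ (S : Fin (τ * m) → Bool) (c : Fin (τ * m) → Fin M) (g : Fin (τ * m)) (i : Fin M),
      ∫⁻ ω, A.pulls (candArm hn g i) ω ∂(A.law (stairLaw ε m S c)) ≠ ⊤ := by
    intro S c g i
    refine ne_top_of_le_ne_top ENNReal.ofReal_ne_top (le_trans ?_ (hsum S c))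
    refine le_trans ?_ (Finset.single_le_sum (fun _ _ => zero_le) (Finset.mem_univ g))
    exact Finset.single_le_sum (f := fun i =>
      ∫⁻ ω, A.pulls (candArm hn g i) ω ∂(A.law (stairLaw ε m S c))) (fun _ _ => zero_le)
      (Finset.mem_univ i)
  refine exp_le_of_sum_le (Nat.mul_pos hτ hm) hM (by positivity)
    (fun g S c => (A.law (stairLaw ε m S c)).real
      {ω | A.Reports ω (bestArm hn (Function.update S g false) c)})
    (fun S c g i => (∫⁻ ω, A.pulls (candArm hn g i) ω ∂(A.law (stairLaw ε m S c))).toReal)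
    (fun _ _ _ => measureReal_nonneg) (fun _ _ _ _ => ENNReal.toReal_nonneg) ?_ ?_ ?_
  · intro S c g i
    simp only [Function.update_idem, bestArm_update_true]
    set S0 := Function.update S g false
    set S1 := Function.update S g true
    set c1 := Function.update c g i
    have hr := stairMean_mem_Icc (n := n) hε.le hm hmε S1 c1 (candArm hn g i)
    have hdiff : stairMean (n := n) ε m S0 c (candArm hn g i) -
        stairMean (n := n) ε m S1 c1 (candArm hn g i) = -(4 * ε) := by
      rw [stairMean_candArm, stairMean_candArm]
      simp [S0, S1, c1]
    have hc0 := coe_projIcc_stairMean hε.le hm hmε S0 c (candArm hn g i)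
    have hc1 := coe_projIcc_stairMean hε.le hm hmε S1 c1 (candArm hn g i)
    refine A.exp_le_law_reports (stairLaw ε m S0 c) (stairLaw ε m S1 c1) (candArm hn g i)
      (fun b hb => ?_) _ _ rfl rfl ?_ ?_ (by positivity) ?_ _ ?_ (hfin S0 c g i)
    · simp only [stairLaw]
      rw [stairMean_update hn S c g i hb]
    · rw [hc1]; linarith [hr.1]
    · rw [hc1]; linarith [hr.2]
    · rw [hc0, hc1, hdiff]
      set r := stairMean (n := n) ε m S1 c1 (candArm hn g i)
      -- The weight `r` lies in `[1/4, 3/4]`, and `(4ε)^2 / (3/16) = (256/3) * ε^2 ≤ 86 * ε^2`.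
      have hr' : 3 / 16 ≤ r * (1 - r) := by nlinarith [hr.1, hr.2]
      rw [div_le_iff₀ (by linarith)]
      nlinarith [sq_nonneg ε]
    · linarith [hgood S0 c]
  · intro S c
    rw [← Finset.sum_filter]
    refine (A.sum_law_real_reports_le (stairLaw ε m S c) _ (bestArm hn S c)
      (fun g => bestArm hn (Function.update S g false) c) ?_ ?_).trans
      (by linarith [hgood S c])
    · intro g hg g' _ hgg'
      refine bestArm_update_false_ne hn S c ?_
      rw [Function.update_of_ne hgg']
      exact (Finset.mem_filter.1 hg).2
    · intro g hg
      exact bestArm_update_false_ne hn S c (Finset.mem_filter.1 hg).2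
  · intro S c
    have h := ENNReal.toReal_mono ENNReal.ofReal_ne_top (hsum S c)
    rw [ENNReal.toReal_ofReal hV, ENNReal.toReal_sum
      (fun g _ => ENNReal.sum_ne_top.2 fun i _ => hfin S c g i)] at h
    refine le_trans (le_of_eq (Finset.sum_congr rfl fun g _ => ?_)) h
    rw [ENNReal.toReal_sum (fun i _ => hfin S c g i)]

end SamplingAlgorithm

/-! ### Constants and conclusion. -/

/-- Add `19` times the logarithm of `h1` to that of `h2`. Since `δ ≤ 1/4` and `3^5 ≤ 2^8`, the
surplus in `-log δ` absorbs the constants. -/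
theorem log_le_of_exp_le {K δ y : ℝ} (hK : 1 ≤ K) (hδ0 : 0 < δ) (hδ : δ ≤ 1 / 4)
    (h1 : 1 / 3 * Real.exp (-y) ≤ δ) (h2 : 1 / 3 * Real.exp (-y) ≤ 2 * δ / K) :
    Real.log (16 * K / δ) ≤ 20 * y := by
  have hK0 : 0 < K := by linarith
  have l1 := Real.log_le_log (by positivity) h1
  have l2 := Real.log_le_log (by positivity) h2
  have l3 := Real.log_le_log hδ0 hδ
  have e4 : Real.log (1 / 4) = -(2 * Real.log 2) := by
    rw [Real.log_div one_ne_zero (by norm_num), Real.log_one,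
      show (4 : ℝ) = 2 ^ 2 by norm_num, Real.log_pow]; push_cast; ring
  have e3 : Real.log (1 / 3 * Real.exp (-y)) = -Real.log 3 - y := by
    rw [Real.log_mul (by norm_num) (Real.exp_pos _).ne', Real.log_exp,
      Real.log_div one_ne_zero (by norm_num), Real.log_one]; ring
  have e5 : Real.log (2 * δ / K) = Real.log 2 + Real.log δ - Real.log K := by
    rw [Real.log_div (by positivity) hK0.ne', Real.log_mul (by norm_num) hδ0.ne']
  have e6 : Real.log (16 * K / δ) = 4 * Real.log 2 + Real.log K - Real.log δ := by
    rw [Real.log_div (by positivity) hδ0.ne', Real.log_mul (by norm_num) hK0.ne',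
      show (16 : ℝ) = 2 ^ 4 by norm_num, Real.log_pow]; push_cast; ring
  have e7 : 5 * Real.log 3 ≤ 8 * Real.log 2 := by
    have h := Real.log_le_log (by norm_num) (show (3 : ℝ) ^ 5 ≤ 2 ^ 8 by norm_num)
    rw [Real.log_pow, Real.log_pow] at h
    push_cast at h
    exact h
  have hkl := Real.log_nonneg hK
  rw [e6]
  rw [e3] at l1 l2
  rw [e5] at l2
  rw [e4] at l3
  linarith

theorem mainTheorem4 :
    ∃ c : ℝ, 0 < c ∧
      ∀ (τ : ℕ), 1 ≤ τ →
      ∀ (ε : ℝ), 0 < ε → ε ≤ 1 / 8 →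
      ∀ (n : ℕ), (τ : ℝ) / (4 * ε) ≤ (n : ℝ) →
      ∃ (q : ℕ) (R : RangeInstance n q),
        R.OptimalHittingSetSize τ ∧
        ∀ (δ : ℝ), 0 < δ → δ ≤ 1 / 4 →
        ∀ (A : SamplingAlgorithm.{u} n q), A.IsPAC R ε δ →
        ∃ ν : Fin n → ProbabilityMeasure ℝ, SupportedOnUnit ν ∧
          ENNReal.ofReal (c * ((n : ℝ) / ε ^ 2) * Real.log ((τ : ℝ) / (ε * δ))) ≤
            A.expectedSamples ν := by
  refine ⟨1 / 70000, by norm_num, fun τ hτ ε hε0 hε n hn => ?_⟩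
  -- The longest staircase with `8 * ε * m ≤ 1`, which keeps the weights in `[1/4, 3/4]`. Rounding
  -- down loses at most a factor `2`, so `16 * ε * m ≥ 1`.
  obtain ⟨m, hm⟩ : ∃ m, m = ⌊1 / (8 * ε)⌋₊ := ⟨_, rfl⟩
  have h1ε : 1 ≤ 1 / (8 * ε) := by rw [le_div_iff₀ (by positivity)]; linarith
  have hm1 : 1 ≤ m := by rw [hm]; exact Nat.le_floor (by simpa using h1ε)
  have hmle : (m : ℝ) ≤ 1 / (8 * ε) := by rw [hm]; exact Nat.floor_le (by positivity)
  have hmlt : 1 / (8 * ε) < m + 1 := by rw [hm]; exact Nat.lt_floor_add_one _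
  have hmε : 8 * ε * m ≤ 1 := by
    rw [le_div_iff₀ (by positivity)] at hmle; linarith
  have hm16 : 1 ≤ 16 * (ε * m) := by
    rw [div_lt_iff₀ (by positivity)] at hmlt
    have : (1 : ℝ) ≤ m := by exact_mod_cast hm1
    nlinarith
  have hτ' : (1 : ℝ) ≤ τ := by exact_mod_cast hτ
  obtain ⟨K, hKdef⟩ : ∃ K, K = τ * m := ⟨_, rfl⟩
  have hK1 : 1 ≤ K := hKdef ▸ Nat.mul_pos hτ hm1
  have h2K : 2 * K ≤ n := by
    have : ((2 * K : ℕ) : ℝ) ≤ n := by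
      refine le_trans ?_ hn
      rw [le_div_iff₀ (by positivity), hKdef]
      push_cast
      nlinarith
    exact_mod_cast this
  -- One of the `n / K` arms per group is the reference; `2 * K ≤ n` leaves at least one candidate.
  obtain ⟨M, hMdef⟩ : ∃ M, M + 1 = n / K := by
    refine ⟨n / K - 1, Nat.sub_add_cancel ?_⟩
    exact (Nat.le_div_iff_mul_le hK1).2 (by omega)
  have hM1 : 1 ≤ M := by
    have : 2 ≤ n / K := (Nat.le_div_iff_mul_le hK1).2 h2K
    omega
  have hKM : K * (M + 1) ≤ n := by rw [hMdef]; exact Nat.mul_div_le n K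
  have hnKM : n ≤ 3 * (K * M) := by
    have h1 : n < K * (n / K + 1) := Nat.lt_mul_div_succ n hK1
    rw [← hMdef] at h1
    have h2 : K * (M + 1 + 1) ≤ K * (3 * M) := Nat.mul_le_mul_left K (by omega)
    have h3 : K * (3 * M) = 3 * (K * M) := by ring
    omega
  have hKn : τ * m ≤ n := by omega
  refine ⟨τ * m, stairInstance τ m n hKn, optimalHittingSetSize_stairInstance hm1 hKn,
    fun δ hδ0 hδ A hA => ?_⟩
  by_contra hcon
  push Not at hcon
  set L := Real.log ((τ : ℝ) / (ε * δ)) with hL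
  set V := 1 / 70000 * ((n : ℝ) / ε ^ 2) * L with hV
  have hL0 : 0 < L := by
    refine Real.log_pos ?_
    rw [lt_div_iff₀ (by positivity)]
    nlinarith
  have hn0 : (0 : ℝ) < n := Nat.cast_pos.2 (by omega)
  have hV0 : 0 < V := by positivity
  subst hKdef
  obtain ⟨b1, b2⟩ := A.exp_le_of_isPAC_stairInstance hτ hm1 hM1 hKn hKM hε0 hmε hδ hV0.le hA
    (fun S c => (hcon _ (supportedOnUnit_stairLaw S c)).le)
  have hlog := log_le_of_exp_le (by exact_mod_cast hK1) hδ0 hδ b1 b2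
  have hLle : L ≤ Real.log (16 * (τ * m : ℕ) / δ) := by
    refine Real.log_le_log (by positivity) ?_
    rw [div_le_div_iff₀ (by positivity) hδ0]
    push_cast
    have : (τ : ℝ) * δ * 1 ≤ τ * δ * (16 * (ε * m)) :=
      mul_le_mul_of_nonneg_left hm16 (by positivity)
    linarith
  have hP : (0 : ℝ) < (τ * m : ℕ) * M := by exact_mod_cast Nat.mul_pos hK1 hM1
  have hnP : (n : ℝ) ≤ 3 * ((τ * m : ℕ) * M) := by exact_mod_cast hnKM
  have hy : 20 * (6 * (86 * ε ^ 2) * (2 * V / ((τ * m : ℕ) * M))) =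
      20640 / 70000 * (n / ((τ * m : ℕ) * M)) * L := by
    rw [hV]
    field_simp
    ring
  rw [hy] at hlog
  have h3 : (n : ℝ) / ((τ * m : ℕ) * M) ≤ 3 := by rwa [div_le_iff₀ hP]
  -- Contradiction: `3 * 20640 < 70000`, so `L ≤ 20640/70000 * 3 * L < L`.
  nlinarith
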